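/- Let $\Omega\subset\mathbb{R}^3$ be a bounded domain (nonempty, open, connected) with strong Lipschitz boundary $\Gamma=\partial\Omega$, that is, near each of its boundary points, in suitable orthonormal coordinates, $\Omega$ is the set of points strictly below the graph of a Lipschitz function of two variables, and $\Gamma$ is this graph. Let $\nu$ denote the outer unit normal, defined almost everywhere on $\Gamma$ with respect to surface measure. Let $H^1_n(\Omega)$ be the closure in $H^1(\Omega;\mathbb{R}^3)$ of the set of restrictions $v|_\Omega$ of fields $v\in C_c^\infty(\mathbb{R}^3;\mathbb{R}^3)$ with $\nu\cdot v=0$ almost everywhere on $\Gamma$, and let $\mathcal{R}=\{x\mapsto Sx+a : S\in\mathbb{R}^{3\times3},\ S^{T}=-S,\ a\in\mathbb{R}^3\}$ be the space of rigid motions. Call $\Omega$ axisymmetric with respect to a line $g$ if it is a body of rotation around $g$, i.e. if every rotation about $g$ maps $\Omega$ onto itself. Write $\wedge$ for the vector product. (i) Let $\sigma,b\in\mathbb{R}^3$ with $|\sigma|=1$, and assume that $\Omega$ is axisymmetric with respect to the axis $g=\{\lambda\sigma+b:\lambda\in\mathbb{R}\}$. Then the vector field $r(x)=\sigma\wedge(x-b)$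 belongs to $\mathcal{R}\cap H^1_n(\Omega)$. (ii) Let $0\neq r\in\mathcal{R}\cap H^1_n(\Omega)$ be given by $r(x)=\omega\,\sigma\wedge x+b$ for all $x\in\mathbb{R}^3$, with $\sigma,b\in\mathbb{R}^3$, $|\sigma|=1$ and $\omega\in\mathbb{R}$. Then $\omega\neq0$, $\langle b,\sigma\rangle=0$, and $\Omega$ is axisymmetric with respect to the axis $g=\{\lambda\sigma+\tfrac1\omega\,\sigma\wedge b:\lambda\in\mathbb{R}\}$. -/

import Mathlib

noncomputable section

namespace RotBody

open MeasureTheory Set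
open scoped ContDiff

/-- Euclidean three-space. -/
abbrev E3 := EuclideanSpace ℝ (Fin 3)

/-- The Euclidean plane. -/
abbrev E2 := EuclideanSpace ℝ (Fin 2)

/-- The vector product `a ∧ b` in three-space. -/
def cross (a b : E3) : E3 := WithLp.toLp 2 (crossProduct a.ofLp b.ofLp)

/-- The first two coordinates `y' = (y₁, y₂)` of `y = (y₁, y₂, y₃)`. -/
def horiz (y : E3) : E2 := !₂[y 0, y 1]

/-- On the open set `U`, in the orthonormal coordinates `y = L x`, the set `Ω` is the part strictly
below the graph of the Lipschitz function `h`, and its boundary is the graph of `h`. -/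
structure IsGraphChart (Ω U : Set E3) (L : E3 ≃ₗᵢ[ℝ] E3) (h : E2 → ℝ) : Prop where
  isOpen : IsOpen U
  lipschitz : ∃ K, LipschitzWith K h
  mem_iff : ∀ x ∈ U, (x ∈ Ω ↔ (L x) 2 < h (horiz (L x)))
  mem_frontier_iff : ∀ x ∈ U, (x ∈ frontier Ω ↔ (L x) 2 = h (horiz (L x)))

/-- Bounded domains (nonempty, connected, open) with strong Lipschitz boundary. -/
structure IsBoundedLipschitzDomain (Ω : Set E3) : Prop where
  isOpen : IsOpen Ω
  isConnected : IsConnected Ω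
  isBounded : Bornology.IsBounded Ω
  boundary : ∀ p ∈ frontier Ω, ∃ (U : Set E3) (L : E3 ≃ₗᵢ[ℝ] E3) (h : E2 → ℝ),
    p ∈ U ∧ IsGraphChart Ω U L h

/-- The unit normal at `(y', h y')` to the graph of `h` that points upwards,
`(-∇h(y'), 1) / √(1 + |∇h(y')|²)`. -/
def graphNormal (h : E2 → ℝ) (y' : E2) : E3 :=
  (√(1 + ‖gradient h y'‖ ^ 2))⁻¹ • !₂[-(gradient h y' 0), -(gradient h y' 1), 1]

/-- `n` is the outer unit normal of `Ω` at the boundary point `x`. For a Lipschitz domain it exists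
at almost every boundary point with respect to surface measure (Rademacher); it does not depend on
the chart. -/
def IsOuterUnitNormal (Ω : Set E3) (x n : E3) : Prop :=
  x ∈ frontier Ω ∧ ∃ (U : Set E3) (L : E3 ≃ₗᵢ[ℝ] E3) (h : E2 → ℝ),
    IsGraphChart Ω U L h ∧ x ∈ U ∧ DifferentiableAt ℝ h (horiz (L x)) ∧
      n = L.symm (graphNormal h (horiz (L x)))

/-- `ν · v = 0` almost everywhere on `∂Ω` with respect to surface measure, that is,
two-dimensional Hausdorff measure. -/
def NormalComponentVanishes (Ω : Set E3) (v : E3 → E3) : Prop :=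
  ∀ᵐ x ∂((μH[2] : Measure E3).restrict (frontier Ω)),
    ∀ n : E3, IsOuterUnitNormal Ω x n → inner ℝ n (v x) = 0

/-- Smooth, compactly supported vector fields on three-space with vanishing normal component
on `∂Ω`. -/
def normalTestFields (Ω : Set E3) : Set (E3 → E3) :=
  {v | ContDiff ℝ ∞ v ∧ HasCompactSupport v ∧ NormalComponentVanishes Ω v}

/-- `G` is the weak derivative of the vector field `v` in the open set `Ω`; used only for square
integrable `v` and `G`. -/
def IsWeakDeriv (Ω : Set E3) (v : E3 → E3) (G : E3 → E3 →L[ℝ] E3) : Prop :=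
  ∀ φ : E3 → ℝ, ContDiff ℝ ∞ φ → HasCompactSupport φ → tsupport φ ⊆ Ω → ∀ e : E3,
    ∫ x in Ω, (fderiv ℝ φ x e) • v x = -∫ x in Ω, φ x • G x e

/-- `v` is in the vector valued Sobolev space `H¹(Ω)`, with weak derivative `G`. -/
structure HasH1Deriv (Ω : Set E3) (v : E3 → E3) (G : E3 → E3 →L[ℝ] E3) : Prop where
  memLp : MemLp v 2 (volume.restrict Ω)
  memLp_deriv : MemLp G 2 (volume.restrict Ω)
  weakDeriv : IsWeakDeriv Ω v G

/-- The space `H¹ₙ(Ω)`: the closure in `H¹(Ω)` of the restrictions to `Ω` of the test fields with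
vanishing normal component. Fields are represented by functions on three-space of which only the
restriction to `Ω`, up to null sets, matters. -/
def H1n (Ω : Set E3) : Set (E3 → E3) :=
  {v | ∃ G : E3 → E3 →L[ℝ] E3, HasH1Deriv Ω v G ∧
    ∀ ε : ENNReal, 0 < ε → ∃ φ ∈ normalTestFields Ω,
      eLpNorm (fun x => v x - φ x) 2 (volume.restrict Ω) < ε ∧
      eLpNorm (fun x => G x - fderiv ℝ φ x) 2 (volume.restrict Ω) < ε}

/-- The rigid motions `x ↦ S x + a` with `S` a skew-symmetric matrix. -/
def rigidMotions : Set (E3 → E3) :=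
  {r | ∃ (S : Matrix (Fin 3) (Fin 3) ℝ) (a : E3), S.transpose = -S ∧
    ∀ x, r x = WithLp.toLp 2 (S.mulVec x.ofLp) + a}

/-- The rotation by the angle `θ` about the axis `{l σ + p | l ∈ ℝ}`, where `σ` is a unit vector
(Rodrigues' formula). -/
def axisRotation (σ p : E3) (θ : ℝ) (x : E3) : E3 :=
  p + Real.cos θ • (x - p) + Real.sin θ • cross σ (x - p)
    + ((1 - Real.cos θ) * inner ℝ σ (x - p)) • σ

/-- `Ω` is a body of rotation around the axis `{l σ + p | l ∈ ℝ}`, where `σ` is a unit vector: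
all rotations about this axis map `Ω` onto itself. -/
def IsAxisymmetric (Ω : Set E3) (σ p : E3) : Prop :=
  ∀ θ : ℝ, axisRotation σ p θ '' Ω = Ω

end RotBody

end

noncomputable section

namespace RotBody

open MeasureTheory Set Filter Topology
open scoped ContDiff Manifold

/-! ### Gauss formula below a Lipschitz graph -/

section Subgraph

variable {E : Type*} [NormedAddCommGroup E] [NormedSpace ℝ E] [FiniteDimensional ℝ E]
  [MeasurableSpace E] [BorelSpace E]

/-! For (i), orbits of boundary points under the rotations stay in `∂Ω`, so the rotation field,
being their velocity, is orthogonal to the normal wherever a normal exists. Cutting it off outside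
`Ω` gives a test field that coincides with it on `Ω`.

For (ii), the divergence theorem gives `∫_Ω div (ψ φ) = 0` for every test field `φ` and every smooth
compactly supported `ψ`. This passes to `H¹` limits, and a rigid motion has zero divergence, so `∫_Ω
∇ψ · r = 0` for all `ψ` (`integral_fderiv_rigidMotion_eq_zero`). Linear `ψ`, cut off, yield `∫_Ω ⟨c,
r⟩ = 0`. With `c = b` this excludes `ω = 0`, and with `c = σ` it gives `⟨b, σ⟩ = 0`. Then `r = ω σ ∧
(x - p)` with `p = (1/ω) σ ∧ b`, and the identity says that `∫_Ω ψ ∘ R_θ` has zero derivative in the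
angle `θ`, where `R_θ` rotates about the axis through `p`. Bump functions supported off `closure Ω`
show that `R_θ Ω ⊆ closure Ω` (`axisRotation_mem_closure`), and the graph property of the boundary
improves this to `R_θ Ω ⊆ Ω`.

The divergence theorem (`setIntegral_divergence_eq_zero`) is reduced to graph charts by a partition
of unity. No surface integral is needed: the boundary term is an integral over the parameter plane,
and null sets of `∂Ω` project to null sets there. -/

theorem integral_fderiv_eq_zero_of_lipschitz {μ : Measure E} [μ.IsAddHaarMeasure] {g : E → ℝ}
    {C : NNReal} (hg : LipschitzWith C g) (hc : HasCompactSupport g) (v : E) :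
    ∫ x, fderiv ℝ g x v ∂μ = 0 := by
  -- Integration by parts against the constant 1. The direction changes sign when the derivative is
  -- moved, hence `-v`.
  have h1 := (LipschitzWith.const (1 : ℝ)).integral_lineDeriv_mul_eq (μ := μ) hg hc (-v)
  have h2 : ∀ x : E, lineDeriv ℝ (fun _ : E => (1 : ℝ)) x (-v) = 0 := fun x => by
    simp [lineDeriv]
  simp only [h2, zero_mul, integral_zero, neg_neg, mul_one] at h1
  rw [h1]
  refine integral_congr_ae ?_
  filter_upwards [hg.ae_differentiableAt (μ := μ)] with x hx
  exact hx.lineDeriv_eq_fderiv.symm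

/-- The shear that flattens the graph of a continuous function. -/
def graphShear (h : E → ℝ) (hh : Continuous h) : E × ℝ ≃ₜ E × ℝ where
  toFun p := (p.1, h p.1 + p.2)
  invFun p := (p.1, p.2 - h p.1)
  left_inv p := by simp
  right_inv p := by simp
  continuous_toFun := by fun_prop
  continuous_invFun := by fun_prop

/-- The Gauss formula on the region below a Lipschitz graph. -/
theorem integral_subgraph_fderiv {μ : Measure E} [μ.IsAddHaarMeasure] {h : E → ℝ} {C : NNReal}
    (hh : LipschitzWith C h) {f : E × ℝ → ℝ} (hf : ContDiff ℝ 1 f) (hc : HasCompactSupport f)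
    (e : E × ℝ) :
    ∫ y, (∫ t in Iio (h y), fderiv ℝ f (y, t) e) ∂μ
      = ∫ y, (e.2 - fderiv ℝ h y e.1) * f (y, h y) ∂μ := by
  obtain ⟨D, hD⟩ := hf.lipschitzWith_of_hasCompactSupport hc (by simp)
  have hfd : Differentiable ℝ f := hf.differentiable (by simp)
  have hdc : Continuous (fderiv ℝ f) := hf.continuous_fderiv (by simp)
  have hhc := hh.continuous
  -- After flattening, `J` differentiates `f` along the direction tangent to the sheet through the
  -- point and parallel to the graph, `A` along `e` itself.
  set J : E × ℝ → ℝ := fun p => fderiv ℝ f (p.1, h p.1 + p.2) (e.1, fderiv ℝ h p.1 e.1) with hJ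
  set A : E × ℝ → ℝ := fun p => fderiv ℝ f (p.1, h p.1 + p.2) e with hA
  -- compactness and integrability
  have hsupp : ∀ p, graphShear h hhc p ∉ tsupport f → fderiv ℝ f (p.1, h p.1 + p.2) = 0 := by
    intro p hp
    exact Function.notMem_support.1 fun h' => hp (support_fderiv_subset ℝ h')
  set Q : Set (E × ℝ) := graphShear h hhc ⁻¹' tsupport f with hQ
  have hQc : IsCompact Q := (graphShear h hhc).isCompact_preimage.2 hc
  have hbound : ∀ p, ‖fderiv ℝ f p‖ ≤ D := fun p => norm_fderiv_le_of_lipschitz ℝ hD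
  -- The integrand is bounded and vanishes off the compact set `Q`. Only measurability of `w` is
  -- required, because `fderiv ℝ h` need not be continuous.
  have key : ∀ w : E × ℝ → E × ℝ, Measurable w → (∃ M, ∀ p, ‖w p‖ ≤ M) →
      Integrable (fun p : E × ℝ => fderiv ℝ f (p.1, h p.1 + p.2) (w p))
        (μ.prod (volume.restrict (Iio 0))) := by
    rintro w hw ⟨M, hM⟩
    have hon : IntegrableOn (fun p : E × ℝ => fderiv ℝ f (p.1, h p.1 + p.2) (w p)) Q
        (μ.prod (volume.restrict (Iio 0))) := by
      refine Measure.integrableOn_of_bounded (M := D * M) ?_ ?_ ?_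
      · exact hQc.measure_lt_top.ne
      · have h1 : Measurable fun p : E × ℝ => fderiv ℝ f (p.1, h p.1 + p.2) :=
          (hdc.comp (graphShear h hhc).continuous).measurable
        have : Measurable fun p : E × ℝ => fderiv ℝ f (p.1, h p.1 + p.2) (w p) :=
          (isBoundedBilinearMap_apply (𝕜 := ℝ) (E := E × ℝ) (F := ℝ)).continuous.measurable.comp
            (h1.prodMk hw)
        exact this.aestronglyMeasurable
      · refine Eventually.of_forall fun p => (ContinuousLinearMap.le_opNorm _ _).trans ?_
        exact mul_le_mul (hbound _) (hM p) (norm_nonneg _) D.coe_nonneg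
    refine (integrableOn_iff_integrable_of_support_subset ?_).1 hon
    intro p hp
    by_contra hpQ
    exact hp (by simp [hsupp p hpQ])
  have hdh : Measurable (fun p : E × ℝ => fderiv ℝ h p.1 e.1) :=
    (measurable_fderiv_apply_const ℝ h e.1).comp measurable_fst
  have hJi : Integrable J (μ.prod (volume.restrict (Iio 0))) := by
    refine key (fun p => (e.1, fderiv ℝ h p.1 e.1)) (measurable_const.prodMk hdh)
      ⟨max ‖e.1‖ (C * ‖e.1‖), fun p => ?_⟩
    rw [Prod.norm_mk]
    refine max_le_max le_rfl ((ContinuousLinearMap.le_opNorm _ _).trans ?_)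
    exact mul_le_mul_of_nonneg_right (norm_fderiv_le_of_lipschitz ℝ hh) (norm_nonneg _)
  have hAi : Integrable A (μ.prod (volume.restrict (Iio 0))) :=
    key (fun _ => e) measurable_const ⟨‖e‖, fun _ => le_rfl⟩
  -- integrals over the sheets parallel to the graph vanish
  have hsheet : ∀ s : ℝ, ∫ y, J (y, s) ∂μ = 0 := by
    intro s
    have hgs : LipschitzWith (D * max 1 C) (fun y => f (y, h y + s)) := by
      refine hD.comp (LipschitzWith.id.prodMk ?_)
      simpa using hh.add (LipschitzWith.const s)
    have hgc : HasCompactSupport (fun y => f (y, h y + s)) := by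
      refine HasCompactSupport.intro (hc.isCompact.image continuous_fst) fun y hy => ?_
      by_contra hne
      exact hy ⟨(y, h y + s), subset_tsupport _ hne, rfl⟩
    rw [← integral_fderiv_eq_zero_of_lipschitz (μ := μ) hgs hgc e.1]
    refine integral_congr_ae ?_
    filter_upwards [hh.ae_differentiableAt (μ := μ)] with y hy
    have h1 : HasFDerivAt (fun y => (y, h y + s))
        ((ContinuousLinearMap.id ℝ E).prod (fderiv ℝ h y)) y :=
      (hasFDerivAt_id y).prodMk (hy.hasFDerivAt.add_const s)
    have h2 := (hfd (y, h y + s)).hasFDerivAt.comp y h1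
    have h3 := h2.fderiv
    simp only [Function.comp_def] at h3
    rw [h3]; rfl
  have hzero : ∫ y, (∫ s in Iio (0 : ℝ), J (y, s)) ∂μ = 0 := by
    rw [integral_integral_swap (f := fun y s => J (y, s)) hJi]
    simp [hsheet]
  have hvert : ∀ y, ∫ t in Iio (h y), fderiv ℝ f (y, t) (0, 1) = f (y, h y) := by
    intro y
    have hd : ∀ t, HasDerivAt (fun t => f (y, t)) (fderiv ℝ f (y, t) (0, 1)) t := fun t =>
      (hfd (y, t)).hasFDerivAt.comp_hasDerivAt t ((hasDerivAt_const t y).prodMk (hasDerivAt_id t))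
    have hcy : HasCompactSupport (fun t => f (y, t)) := by
      refine HasCompactSupport.intro (hc.isCompact.image continuous_snd) fun t ht => ?_
      by_contra hne
      exact ht ⟨(y, t), subset_tsupport _ hne, rfl⟩
    have hcd : ContDiff ℝ 1 (fun t => f (y, t)) := hf.comp (by fun_prop)
    have := HasCompactSupport.integral_Iic_deriv_eq hcd hcy (h y)
    rw [integral_Iic_eq_integral_Iio] at this
    rw [← this]
    exact integral_congr_ae (Eventually.of_forall fun t => (hd t).deriv.symm)
  have hshift : ∀ (y : E) (v : E × ℝ), ∫ s in Iio (0 : ℝ), fderiv ℝ f (y, h y + s) v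
      = ∫ t in Iio (h y), fderiv ℝ f (y, t) v := by
    intro y v
    have hmp := (measurePreserving_add_left (volume : Measure ℝ) (h y)).setIntegral_preimage_emb
      (measurableEmbedding_addLeft (h y)) (fun t => fderiv ℝ f (y, t) v) (Iio (h y))
    rw [← hmp]
    congr 2
    ext s; simp
  have hcpt : ∀ y, ∀ v : E × ℝ,
      IntegrableOn (fun s => fderiv ℝ f (y, h y + s) v) (Iio (0 : ℝ)) := by
    intro y v
    refine (Continuous.integrable_of_hasCompactSupport (by fun_prop) ?_).integrableOn
    refine HasCompactSupport.intro (hQc.image continuous_snd) fun t ht => ?_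
    have := hsupp (y, t) fun h' => ht ⟨(y, t), h', rfl⟩
    simp only at this
    simp [this]
  have hsplit : ∀ y, ∫ s in Iio (0 : ℝ), J (y, s)
      = (∫ t in Iio (h y), fderiv ℝ f (y, t) e) - (e.2 - fderiv ℝ h y e.1) * f (y, h y) := by
    intro y
    -- The tangent vector is `e` minus a vertical vector. The vertical part integrates to the
    -- boundary value by `hvert`.
    have h1 : ∀ s, J (y, s) = fderiv ℝ f (y, h y + s) e
        - (e.2 - fderiv ℝ h y e.1) * fderiv ℝ f (y, h y + s) (0, 1) := by
      intro s
      have : (e.1, fderiv ℝ h y e.1) = e - (e.2 - fderiv ℝ h y e.1) • ((0 : E), (1 : ℝ)) := by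
        ext <;> simp
      simp only [hJ]
      rw [this, map_sub, map_smul, smul_eq_mul]
    simp only [h1]
    rw [integral_sub (hcpt y e) ((hcpt y _).const_mul _), integral_const_mul, hshift, hshift, hvert]
  simp only [hsplit] at hzero
  have hI1 : Integrable (fun y => ∫ t in Iio (h y), fderiv ℝ f (y, t) e) μ := by
    have := hAi.integral_prod_left
    simpa only [hA, hshift] using this
  have hI2 : Integrable (fun y => (e.2 - fderiv ℝ h y e.1) * f (y, h y)) μ := by
    have := hJi.integral_prod_left
    simp only [hsplit] at this
    refine (hI1.sub this).congr (Eventually.of_forall fun y => ?_)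
    simp
  rw [integral_sub hI1 hI2] at hzero
  linarith

end Subgraph

/-! ### The divergence theorem in a graph chart -/

/-- The standard basis vectors of three-space. -/
def stdVec (i : Fin 3) : E3 := EuclideanSpace.single i 1

/-- The divergence of a vector field. -/
def divergence (v : E3 → E3) (x : E3) : ℝ := ∑ i, (fderiv ℝ v x (stdVec i)) i

theorem sum_smul_stdVec (v : E3) : ∑ i, v i • stdVec i = v := by
  ext j
  fin_cases j <;> simp [stdVec, Fin.sum_univ_three]

/-- Splitting of three-space into horizontal and vertical coordinates. -/
def splitCoord : E3 ≃L[ℝ] E2 × ℝ :=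
  LinearEquiv.toContinuousLinearEquiv
    { toFun := fun y => (horiz y, y 2)
      invFun := fun p => !₂[p.1 0, p.1 1, p.2]
      left_inv := fun y => by ext i; fin_cases i <;> simp [horiz]
      right_inv := fun p => by
        ext i
        · fin_cases i <;> simp [horiz]
        · simp
      map_add' := fun x y => by
        ext i
        · fin_cases i <;> simp [horiz]
        · simp
      map_smul' := fun c y => by
        ext i
        · fin_cases i <;> simp [horiz]
        · simp }

theorem horiz_splitCoord_symm (p : E2 × ℝ) : horiz (splitCoord.symm p) = p.1 :=
  congrArg Prod.fst (splitCoord.apply_symm_apply p)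

theorem splitCoord_symm_two (p : E2 × ℝ) : (splitCoord.symm p) 2 = p.2 := by
  change (splitCoord (splitCoord.symm p)).2 = p.2
  rw [splitCoord.apply_symm_apply]

theorem measurePreserving_splitCoord : MeasurePreserving splitCoord volume volume := by
  have h1 := PiLp.volume_preserving_ofLp (Fin 3)
  have h2 := volume_preserving_piFinSuccAbove (fun _ : Fin 3 => ℝ) 2
  have h3 : MeasurePreserving (Prod.swap : ℝ × (Fin 2 → ℝ) → (Fin 2 → ℝ) × ℝ) volume volume :=
    Measure.measurePreserving_swap
  have h5 : MeasurePreserving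
      (Prod.map (WithLp.toLp 2 : (Fin 2 → ℝ) → E2) (id : ℝ → ℝ)) volume volume :=
    (PiLp.volume_preserving_toLp (Fin 2)).prod (MeasurePreserving.id volume)
  have h6 : ⇑splitCoord = Prod.map (WithLp.toLp 2) id ∘ Prod.swap ∘
      MeasurableEquiv.piFinSuccAbove (fun _ : Fin 3 => ℝ) 2 ∘ WithLp.ofLp := by
    funext y
    refine Prod.ext ?_ rfl
    ext i
    fin_cases i <;> rfl
  rw [h6]
  exact h5.comp (h3.comp (h2.comp h1))

theorem norm_horiz_le (y : E3) : ‖horiz y‖ ≤ ‖y‖ := by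
  rw [EuclideanSpace.norm_eq, EuclideanSpace.norm_eq]
  refine Real.sqrt_le_sqrt ?_
  simp [horiz, Fin.sum_univ_three]
  positivity

theorem lipschitzWith_horiz : LipschitzWith 1 horiz := by
  refine LipschitzWith.of_dist_le_mul fun x y => ?_
  have : horiz x - horiz y = horiz (x - y) := by
    ext i; fin_cases i <;> simp [horiz]
  rw [dist_eq_norm, dist_eq_norm, this]
  simpa using norm_horiz_le (x - y)

/-- The identity from the Euclidean to the sup norm is 1-Lipschitz, and for the sup norm Hausdorff
and Lebesgue measure coincide. -/
theorem volume_eq_zero_of_hausdorffMeasure_eq_zero {s : Set E2}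
    (hs : (μH[2] : Measure E2) s = 0) : volume s = 0 := by
  have hl : LipschitzWith 1 (WithLp.ofLp : E2 → Fin 2 → ℝ) := PiLp.lipschitzWith_ofLp 2 _
  have h1 := hl.hausdorffMeasure_image_le (d := 2) (by norm_num) s
  rw [hs] at h1
  have h2 : (volume : Measure (Fin 2 → ℝ)) (WithLp.ofLp '' s) = 0 := by
    rw [← hausdorffMeasure_pi_real]
    simpa using h1
  refine measure_mono_null (fun x hx => ?_)
    ((PiLp.volume_preserving_ofLp (Fin 2)).quasiMeasurePreserving.preimage_null h2)
  exact ⟨x, hx, rfl⟩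

/-- The Gauss formula inside a graph chart. -/
theorem IsGraphChart.setIntegral_fderiv {Ω U : Set E3} {L : E3 ≃ₗᵢ[ℝ] E3} {h : E2 → ℝ}
    (hΩ : IsOpen Ω) (hchart : IsGraphChart Ω U L h) {f : E3 → ℝ} (hf : ContDiff ℝ 1 f)
    (hc : HasCompactSupport f) (hU : tsupport f ⊆ U) (e : E3) :
    ∫ x in Ω, fderiv ℝ f x e = ∫ y : E2, ((L e) 2 - fderiv ℝ h y (horiz (L e))) *
      f (L.symm (splitCoord.symm (y, h y))) := by
  obtain ⟨C, hC⟩ := hchart.lipschitz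
  set Φ : E3 ≃L[ℝ] E2 × ℝ := L.toContinuousLinearEquiv.trans splitCoord with hΦ
  have hΦm : MeasurePreserving Φ volume volume :=
    measurePreserving_splitCoord.comp L.measurePreserving
  set g : E2 × ℝ → ℝ := fun p => f (Φ.symm p) with hg
  have hgd : ContDiff ℝ 1 g := hf.comp Φ.symm.contDiff
  have hgc : HasCompactSupport g := hc.comp_homeomorph Φ.symm.toHomeomorph
  have hfd : Differentiable ℝ f := hf.differentiable (by simp)
  have hfderiv : ∀ x, fderiv ℝ f x e = fderiv ℝ g (Φ x) (Φ e) := by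
    intro x
    have h1 : HasFDerivAt g ((fderiv ℝ f (Φ.symm (Φ x))).comp (Φ.symm : E2 × ℝ →L[ℝ] E3)) (Φ x) :=
      (hfd _).hasFDerivAt.comp _ Φ.symm.hasFDerivAt
    rw [h1.fderiv]
    simp
  set V : Set (E2 × ℝ) := {p | p.2 < h p.1} with hV
  have hVo : IsOpen V := isOpen_lt continuous_snd (hC.continuous.comp continuous_fst)
  -- Inside `U` the chart identifies `Ω` with the subgraph; outside `U` the derivative of `f`
  -- vanishes.
  have hind : Ω.indicator (fun x => fderiv ℝ f x e)
      = fun x => V.indicator (fun p => fderiv ℝ g p (Φ e)) (Φ x) := by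
    ext x
    by_cases hx : x ∈ U
    · have := hchart.mem_iff x hx
      have h2 : Φ x ∈ V ↔ (L x) 2 < h (horiz (L x)) := Iff.rfl
      by_cases hxΩ : x ∈ Ω
      · rw [indicator_of_mem hxΩ, indicator_of_mem (h2.2 (this.1 hxΩ)), hfderiv]
      · rw [indicator_of_notMem hxΩ, indicator_of_notMem fun h' => hxΩ (this.2 (h2.1 h'))]
    · have h0 : fderiv ℝ f x e = 0 := by
        rw [Function.notMem_support.1 fun h' => hx (hU (support_fderiv_subset ℝ h'))]; rfl
      have h0' := (hfderiv x).symm.trans h0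
      have e1 : Ω.indicator (fun x => fderiv ℝ f x e) x = 0 :=
        indicator_apply_eq_zero.2 fun _ => h0
      have e2 : V.indicator (fun p => fderiv ℝ g p (Φ e)) (Φ x) = 0 :=
        indicator_apply_eq_zero.2 fun _ => h0'
      rw [e1, e2]
  have hcont : Continuous fun p => fderiv ℝ g p (Φ e) :=
    (hgd.continuous_fderiv (by simp)).clm_apply continuous_const
  have hint : Integrable (fun p => fderiv ℝ g p (Φ e)) :=
    hcont.integrable_of_hasCompactSupport (hgc.fderiv_apply (𝕜 := ℝ) (Φ e))
  rw [← integral_indicator hΩ.measurableSet, hind,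
    hΦm.integral_comp Φ.toHomeomorph.measurableEmbedding,
    Measure.volume_eq_prod, integral_prod _ (hint.indicator hVo.measurableSet)]
  have := integral_subgraph_fderiv (μ := (volume : Measure E2)) hC hgd hgc (Φ e)
  refine Eq.trans ?_ this
  refine integral_congr_ae (Eventually.of_forall fun y => ?_)
  simp only
  rw [← integral_indicator measurableSet_Iio]
  rfl

/-- The weight in the Gauss formula is thus the normal component up to a positive factor, so that a
vanishing normal component makes the boundary integrand zero. -/
theorem inner_graphNormal (h : E2 → ℝ) (y : E2) (w : E3) :
    inner ℝ (graphNormal h y) w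
      = (√(1 + ‖gradient h y‖ ^ 2))⁻¹ * (w 2 - fderiv ℝ h y (horiz w)) := by
  have h1 : fderiv ℝ h y (horiz w) = inner ℝ (gradient h y) (horiz w) := by
    rw [gradient, InnerProductSpace.toDual_symm_apply]
  rw [h1, graphNormal, real_inner_smul_left]
  congr 1
  rw [PiLp.inner_apply, PiLp.inner_apply, Fin.sum_univ_three, Fin.sum_univ_two]
  simp [horiz]
  ring

theorem divergence_eq_sum {v : E3 → E3} (hv : Differentiable ℝ v) (x : E3) :
    divergence v x = ∑ i, fderiv ℝ (fun z => v z i) x (stdVec i) := by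
  refine Finset.sum_congr rfl fun i _ => ?_
  have h1 : HasFDerivAt (fun z => v z i)
      ((EuclideanSpace.proj i : E3 →L[ℝ] ℝ).comp (fderiv ℝ v x)) x :=
    (EuclideanSpace.proj i : E3 →L[ℝ] ℝ).hasFDerivAt.comp x (hv x).hasFDerivAt
  rw [h1.fderiv]
  rfl

theorem IsGraphChart.setIntegral_divergence_eq_zero {Ω U : Set E3} {L : E3 ≃ₗᵢ[ℝ] E3} {h : E2 → ℝ}
    (hΩ : IsOpen Ω) (hchart : IsGraphChart Ω U L h) {v : E3 → E3} (hv : ContDiff ℝ 1 v)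
    (hc : HasCompactSupport v) (hU : tsupport v ⊆ U) (hn : NormalComponentVanishes Ω v) :
    ∫ x in Ω, divergence v x = 0 := by
  have hvd : Differentiable ℝ v := hv.differentiable (by simp)
  have hvi : ∀ i, ContDiff ℝ 1 fun z => v z i := fun i =>
    (EuclideanSpace.proj i : E3 →L[ℝ] ℝ).contDiff.comp hv
  have hci : ∀ i, HasCompactSupport fun z => v z i := fun i =>
    hc.comp_left (g := fun w : E3 => w i) rfl
  have hUi : ∀ i, tsupport (fun z => v z i) ⊆ U := fun i =>
    (tsupport_comp_subset (g := fun w : E3 => w i) rfl v).trans hU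
  have hint : ∀ i, Integrable (fun x => fderiv ℝ (fun z => v z i) x (stdVec i))
      (volume.restrict Ω) := fun i =>
    ((((hvi i).continuous_fderiv (by simp)).clm_apply continuous_const).integrable_of_hasCompactSupport
      ((hci i).fderiv_apply (𝕜 := ℝ) _)).integrableOn
  obtain ⟨C, hC⟩ := hchart.lipschitz
  set P : E2 → E3 := fun y => L.symm (splitCoord.symm (y, h y)) with hP
  have hPc : Continuous P :=
    L.symm.continuous.comp (splitCoord.symm.continuous.comp
      (continuous_id.prodMk hC.continuous))
  simp only [divergence_eq_sum hvd]
  rw [integral_finsetSum _ fun i _ => hint i]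
  have hLP : ∀ y, L (P y) = splitCoord.symm (y, h y) := fun y => L.apply_symm_apply _
  have hhor : ∀ y, horiz (L (P y)) = y := fun y => by rw [hLP, horiz_splitCoord_symm]
  have hver : ∀ y, (L (P y)) 2 = h y := fun y => by rw [hLP, splitCoord_symm_two]
  -- The exceptional boundary points are `μH[2]`-null. The projection `x ↦ horiz (L x)` is
  -- 1-Lipschitz, so their image in the plane is null too; Rademacher supplies differentiability of
  -- `h` elsewhere.
  have hmeas : ∀ᵐ y : E2, P y ∈ U → inner ℝ (graphNormal h y) (L (v (P y))) = 0 := by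
    have h0 : (μH[2] : Measure E3) {x | x ∈ frontier Ω ∧
        ¬ ∀ n : E3, IsOuterUnitNormal Ω x n → inner ℝ n (v x) = 0} = 0 := by
      have := (ae_restrict_iff' isClosed_frontier.measurableSet).1 hn
      rw [ae_iff] at this
      simpa only [Classical.not_imp] using this
    have hl : LipschitzWith 1 (fun x : E3 => horiz (L x)) := by
      have := lipschitzWith_horiz.comp L.lipschitz
      rwa [mul_one] at this
    have h1 := hl.hausdorffMeasure_image_le (d := 2) (by norm_num) {x | x ∈ frontier Ω ∧
        ¬ ∀ n : E3, IsOuterUnitNormal Ω x n → inner ℝ n (v x) = 0}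
    rw [h0, mul_zero] at h1
    have h2 := volume_eq_zero_of_hausdorffMeasure_eq_zero (le_antisymm h1 zero_le)
    filter_upwards [hC.ae_differentiableAt (μ := (volume : Measure E2)),
      measure_eq_zero_iff_ae_notMem.1 h2] with y hy hy2 hyU
    by_contra hne
    have hfr : P y ∈ frontier Ω := (hchart.mem_frontier_iff _ hyU).2 (by rw [hhor, hver])
    refine hy2 ⟨P y, ⟨hfr, fun hall => hne ?_⟩, hhor y⟩
    have := hall (L.symm (graphNormal h y)) ⟨hfr, U, L, h, hchart, hyU, by rwa [hhor], by rw [hhor]⟩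
    rw [← this, ← L.inner_map_map (L.symm _), L.apply_symm_apply]
  have hint2 : ∀ i, Integrable fun y : E2 =>
      ((L (stdVec i)) 2 - fderiv ℝ h y (horiz (L (stdVec i)))) * v (P y) i := by
    intro i
    have hvP : Continuous fun y => v (P y) i := (hvi i).continuous.comp hPc
    have hvPc : HasCompactSupport fun y => v (P y) i := by
      refine HasCompactSupport.intro (hc.isCompact.image (f := fun x => horiz (L x))
        (lipschitzWith_horiz.continuous.comp L.continuous)) fun y hy => ?_
      by_contra hne
      exact hy ⟨P y, subset_tsupport _ fun h0 => hne (by simp [h0]), hhor y⟩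
    refine (hvP.integrable_of_hasCompactSupport hvPc).bdd_mul
      (c := ‖(L (stdVec i)) 2‖ + C * ‖horiz (L (stdVec i))‖) ?_ ?_
    · exact (measurable_const.sub (measurable_fderiv_apply_const ℝ h _)).aestronglyMeasurable
    · refine Eventually.of_forall fun y => (norm_sub_le _ _).trans ?_
      gcongr
      exact (ContinuousLinearMap.le_opNorm _ _).trans
        (mul_le_mul_of_nonneg_right (norm_fderiv_le_of_lipschitz ℝ hC) (norm_nonneg _))
  calc ∑ i, ∫ x in Ω, fderiv ℝ (fun z => v z i) x (stdVec i)
      = ∑ i, ∫ y : E2, ((L (stdVec i)) 2 - fderiv ℝ h y (horiz (L (stdVec i)))) * v (P y) i :=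
        Finset.sum_congr rfl fun i _ => hchart.setIntegral_fderiv hΩ (hvi i) (hci i) (hUi i) _
    _ = ∫ y : E2, ∑ i, ((L (stdVec i)) 2 - fderiv ℝ h y (horiz (L (stdVec i)))) * v (P y) i :=
        (integral_finsetSum _ fun i _ => hint2 i).symm
    _ = ∫ y : E2, (0 : ℝ) := by
        refine integral_congr_ae ?_
        filter_upwards [hmeas] with y hy
        have hlin : ∑ i, ((L (stdVec i)) 2 - fderiv ℝ h y (horiz (L (stdVec i)))) * v (P y) i
            = (L (v (P y))) 2 - fderiv ℝ h y (horiz (L (v (P y)))) := by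
          let ℓ : E3 →ₗ[ℝ] ℝ :=
            ((LinearMap.snd ℝ E2 ℝ) - (fderiv ℝ h y : E2 →ₗ[ℝ] ℝ).comp (LinearMap.fst ℝ E2 ℝ)).comp
              ((splitCoord : E3 →ₗ[ℝ] E2 × ℝ).comp (L.toLinearEquiv : E3 →ₗ[ℝ] E3))
          have hℓ : ∀ w, ℓ w = (L w) 2 - fderiv ℝ h y (horiz (L w)) := fun w => rfl
          rw [← hℓ (v (P y))]
          conv_rhs => rw [← sum_smul_stdVec (v (P y))]
          rw [map_sum]
          refine Finset.sum_congr rfl fun i _ => ?_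
          rw [map_smul, hℓ, smul_eq_mul, mul_comm]
        rw [hlin]
        by_cases hyU : P y ∈ U
        · have := hy hyU
          rw [inner_graphNormal] at this
          refine (mul_eq_zero.1 this).resolve_left (inv_ne_zero (Real.sqrt_ne_zero'.2 ?_))
          positivity
        · have : v (P y) = 0 := by
            by_contra hne
            exact hyU (hU (subset_tsupport _ hne))
          have hz : horiz 0 = 0 := by ext i; fin_cases i <;> simp [horiz]
          simp [this, hz]
    _ = 0 := by simp

/-! ### Globalisation by a partition of unity -/

theorem contDiff_apply_coord {n : WithTop ℕ∞} {v : E3 → E3} (hv : ContDiff ℝ n v) (i : Fin 3) :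
    ContDiff ℝ n fun z => v z i :=
  (EuclideanSpace.proj i : E3 →L[ℝ] ℝ).contDiff.comp hv

theorem continuous_divergence {v : E3 → E3} (hv : ContDiff ℝ 1 v) :
    Continuous (divergence v) := by
  refine continuous_finsetSum _ fun i _ => ?_
  exact (EuclideanSpace.proj i : E3 →L[ℝ] ℝ).continuous.comp
    ((hv.continuous_fderiv (by simp)).clm_apply continuous_const)

theorem support_divergence_subset (v : E3 → E3) :
    Function.support (divergence v) ⊆ tsupport v := by
  intro x hx
  by_contra hne
  refine hx ?_
  have : fderiv ℝ v x = 0 :=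
    Function.notMem_support.1 fun h' => hne (support_fderiv_subset ℝ h')
  simp [divergence, this]

theorem integrable_divergence {v : E3 → E3} (hv : ContDiff ℝ 1 v) (hc : HasCompactSupport v) :
    Integrable (divergence v) :=
  (continuous_divergence hv).integrable_of_hasCompactSupport
    (hc.mono' (support_divergence_subset v))

theorem integral_divergence_eq_zero {v : E3 → E3} (hv : ContDiff ℝ 1 v)
    (hc : HasCompactSupport v) : ∫ x, divergence v x = 0 := by
  simp only [divergence_eq_sum (hv.differentiable (by simp))]
  have hci : ∀ i, HasCompactSupport fun z => v z i := fun i =>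
    hc.comp_left (g := fun w : E3 => w i) rfl
  rw [integral_finsetSum]
  · refine Finset.sum_eq_zero fun i _ => ?_
    obtain ⟨D, hD⟩ := (contDiff_apply_coord hv i).lipschitzWith_of_hasCompactSupport (hci i)
      (by simp)
    exact integral_fderiv_eq_zero_of_lipschitz hD (hci i) _
  · intro i _
    exact (((contDiff_apply_coord hv i).continuous_fderiv (by simp)).clm_apply
      continuous_const).integrable_of_hasCompactSupport ((hci i).fderiv_apply (𝕜 := ℝ) _)

theorem NormalComponentVanishes.smul {Ω : Set E3} {v : E3 → E3} (hv : NormalComponentVanishes Ω v)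
    (ρ : E3 → ℝ) : NormalComponentVanishes Ω fun x => ρ x • v x := by
  filter_upwards [hv] with x hx n hn
  rw [real_inner_smul_right, hx n hn, mul_zero]

theorem exists_finite_partition_of_unity {K : Set E3} (hK : IsCompact K) (U : E3 → Set E3)
    (hUo : ∀ p ∈ K, IsOpen (U p)) (hpU : ∀ p ∈ K, p ∈ U p) :
    ∃ (t : Finset K) (ρ : t → E3 → ℝ), (∀ i, ContDiff ℝ 1 (ρ i)) ∧
      (∀ i, tsupport (ρ i) ⊆ U i.1.1) ∧ ∀ x ∈ K, ∑ i, ρ i x = 1 := by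
  obtain ⟨t, hcover⟩ := hK.elim_nhds_subcover' (fun p _ => U p)
    (fun p hp => (hUo p hp).mem_nhds (hpU p hp))
  obtain ⟨ρ, hρ⟩ := SmoothPartitionOfUnity.exists_isSubordinate 𝓘(ℝ, E3)
    hK.isClosed (fun i : t => U i.1.1) (fun i => hUo _ i.1.2)
    (by simpa only [iUnion_subtype] using hcover)
  refine ⟨t, fun i => ρ i, fun i => (ρ i).contMDiff.contDiff.of_le (by simp), hρ, fun x hx => ?_⟩
  have := ρ.sum_eq_one hx
  rwa [finsum_eq_sum_of_fintype] at this

/-- The sum need only be 1 on `Ω`: since `Ω` is open, `v = ∑ ρ i • v` can be differentiated there.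
-/
theorem setIntegral_divergence_eq_zero_of_sum {Ω : Set E3} (hΩ : IsOpen Ω) {ι : Type*} [Fintype ι]
    (ρ : ι → E3 → ℝ) (hρ : ∀ i, ContDiff ℝ 1 (ρ i)) {v : E3 → E3} (hv : ContDiff ℝ 1 v)
    (hc : HasCompactSupport v) (h1 : ∀ x ∈ Ω, ∑ i, ρ i x = 1)
    (h0 : ∀ i, ∫ x in Ω, divergence (fun x => ρ i x • v x) x = 0) :
    ∫ x in Ω, divergence v x = 0 := by
  have hwd : ∀ i, ContDiff ℝ 1 fun x => ρ i x • v x := fun i => (hρ i).smul hv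
  have hsum : ∀ x ∈ Ω, v x = ∑ i, ρ i x • v x := by
    intro x hx
    rw [← Finset.sum_smul, h1 x hx, one_smul]
  have hdiv : ∀ x ∈ Ω, divergence v x = ∑ i, divergence (fun x => ρ i x • v x) x := by
    intro x hx
    have h1 : fderiv ℝ v x = ∑ i, fderiv ℝ (fun x => ρ i x • v x) x := by
      rw [← fderiv_fun_sum fun i _ => ((hwd i).differentiable (by simp)) x]
      exact (Filter.eventuallyEq_of_mem (hΩ.mem_nhds hx) hsum).fderiv_eq
    simp only [divergence, h1]
    rw [Finset.sum_comm]
    refine Finset.sum_congr rfl fun i _ => ?_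
    simp
  have hcs : ∀ i, HasCompactSupport fun x => ρ i x • v x := fun i => hc.smul_left (f := ρ i)
  rw [setIntegral_congr_fun hΩ.measurableSet hdiv, integral_finsetSum _ fun i _ =>
    (integrable_divergence (hwd i) (hcs i)).integrableOn]
  exact Finset.sum_eq_zero fun i _ => h0 i

/-- The divergence theorem for fields with vanishing normal component. -/
theorem setIntegral_divergence_eq_zero {Ω : Set E3} (hΩ : IsBoundedLipschitzDomain Ω)
    {v : E3 → E3} (hv : ContDiff ℝ 1 v) (hc : HasCompactSupport v)
    (hn : NormalComponentVanishes Ω v) : ∫ x in Ω, divergence v x = 0 := by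
  -- Interior points use `U = Ω`, where the integral extends to the whole space; boundary points use
  -- a chart.
  have hloc : ∀ p ∈ closure Ω, ∃ U : Set E3, IsOpen U ∧ p ∈ U ∧ ∀ w : E3 → E3, ContDiff ℝ 1 w →
      HasCompactSupport w → NormalComponentVanishes Ω w → tsupport w ⊆ U →
      ∫ x in Ω, divergence w x = 0 := by
    intro p hp
    by_cases hpΩ : p ∈ Ω
    · refine ⟨Ω, hΩ.isOpen, hpΩ, fun w hw hwc _ hwΩ => ?_⟩
      rw [setIntegral_eq_integral_of_forall_compl_eq_zero, integral_divergence_eq_zero hw hwc]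
      intro x hx
      by_contra hne
      exact hx (hwΩ (support_divergence_subset w hne))
    · have hpf : p ∈ frontier Ω := by
        rw [hΩ.isOpen.frontier_eq]; exact ⟨hp, hpΩ⟩
      obtain ⟨U, L, h, hpU, hch⟩ := hΩ.boundary p hpf
      exact ⟨U, hch.isOpen, hpU, fun w hw hwc hwn hwU =>
        hch.setIntegral_divergence_eq_zero hΩ.isOpen hw hwc hwU hwn⟩
  choose! U hUo hpU hU using hloc
  obtain ⟨t, ρ, hρd, hρU, hρ1⟩ := exists_finite_partition_of_unity 
    hΩ.isBounded.isCompact_closure U hUo hpU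
  exact setIntegral_divergence_eq_zero_of_sum hΩ.isOpen ρ hρd hv hc
    (fun x hx => hρ1 x (subset_closure hx)) fun i => hU i.1.1 i.1.2 _ ((hρd i).smul hv)
      (hc.smul_left (f := ρ i))
      (hn.smul _) ((closure_mono (Function.support_smul_subset_left _ _)).trans (hρU i))

/-! ### Weak derivatives and the Gauss identity in `H¹ₙ(Ω)` -/

theorem divergence_smul {ψ : E3 → ℝ} {v : E3 → E3} {x : E3} (hψ : DifferentiableAt ℝ ψ x)
    (hv : DifferentiableAt ℝ v x) :
    divergence (fun z => ψ z • v z) x = ψ x * divergence v x + fderiv ℝ ψ x (v x) := by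
  have h1 : fderiv ℝ ψ x (v x) = ∑ i, fderiv ℝ ψ x (stdVec i) * v x i := by
    conv_lhs => rw [← sum_smul_stdVec (v x)]
    rw [map_sum]
    refine Finset.sum_congr rfl fun i _ => ?_
    rw [map_smul, smul_eq_mul, mul_comm]
  rw [h1, divergence, divergence, fderiv_fun_smul hψ hv, Finset.mul_sum, ← Finset.sum_add_distrib]
  refine Finset.sum_congr rfl fun i _ => ?_
  simp

theorem isWeakDeriv_fderiv {Ω : Set E3} {r : E3 → E3} (hr : ContDiff ℝ 1 r) :
    IsWeakDeriv Ω r (fderiv ℝ r) := by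
  intro φ hφ hφc hφΩ e
  have hφ1 : ContDiff ℝ 1 φ := hφ.of_le (by simp)
  have hrc := hr.continuous_fderiv (by simp)
  have hφc' := hφ1.continuous_fderiv (by simp)
  have h0 : ∀ x, x ∉ Ω → φ x = 0 := fun x hx => by
    by_contra hne
    exact hx (hφΩ (subset_tsupport _ hne))
  have h1 : ∀ x, x ∉ Ω → fderiv ℝ φ x = 0 := fun x hx =>
    Function.notMem_support.1 fun h' => hx (hφΩ (support_fderiv_subset ℝ h'))
  rw [setIntegral_eq_integral_of_forall_compl_eq_zero fun x hx => by simp [h1 x hx],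
    setIntegral_eq_integral_of_forall_compl_eq_zero fun x hx => by simp [h0 x hx],
    integral_smul_fderiv_eq_neg_fderiv_smul_of_integrable, neg_neg]
  · exact (Continuous.smul (by fun_prop) hr.continuous).integrable_of_hasCompactSupport
      ((hφc.fderiv_apply (𝕜 := ℝ) e).smul_right)
  · exact (Continuous.smul hφ.continuous (by fun_prop)).integrable_of_hasCompactSupport
      hφc.smul_right
  · exact (Continuous.smul hφ.continuous hr.continuous).integrable_of_hasCompactSupport
      hφc.smul_right
  · exact fun x _ => hφ1.differentiable (by simp) x
  · exact fun x _ => hr.differentiable (by simp) x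

/-- The weak derivative of a continuously differentiable field is its derivative. -/
theorem IsWeakDeriv.ae_eq_fderiv {Ω : Set E3} (hΩ : IsOpen Ω) (hb : Bornology.IsBounded Ω)
    {r : E3 → E3} (hr : ContDiff ℝ 1 r) {G : E3 → E3 →L[ℝ] E3}
    (hG : MemLp G 2 (volume.restrict Ω)) (hw : IsWeakDeriv Ω r G) (e : E3) :
    ∀ᵐ x ∂volume.restrict Ω, G x e = fderiv ℝ r x e := by
  have : IsFiniteMeasure (volume.restrict Ω) := ⟨by simpa using hb.measure_lt_top⟩
  have hGi : Integrable G (volume.restrict Ω) := hG.integrable (by norm_num)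
  have hGe : IntegrableOn (fun x => G x e) Ω :=
    (ContinuousLinearMap.apply ℝ E3 e).integrable_comp hGi
  have hrc : Continuous fun x => fderiv ℝ r x e :=
    (hr.continuous_fderiv (by simp)).clm_apply continuous_const
  have hloc : LocallyIntegrableOn (fun x => G x e - fderiv ℝ r x e) Ω :=
    hGe.locallyIntegrableOn.sub (hrc.locallyIntegrable.locallyIntegrableOn _)
  have := hΩ.ae_eq_zero_of_integral_contDiff_smul_eq_zero (μ := volume) hloc ?_
  · rw [ae_restrict_iff' hΩ.measurableSet]
    filter_upwards [this] with x hx hxΩ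
    exact sub_eq_zero.1 (hx hxΩ)
  · intro g hg hgc hgΩ
    have h0 : ∀ x, x ∉ Ω → g x = 0 := fun x hx => by
      by_contra hne
      exact hx (hgΩ (subset_tsupport _ hne))
    rw [← setIntegral_eq_integral_of_forall_compl_eq_zero (s := Ω) fun x hx => by simp [h0 x hx]]
    simp only [smul_sub]
    obtain ⟨M, hM⟩ := hg.continuous.bounded_above_of_compact_support hgc
    rw [integral_sub]
    · have h1 := hw g hg hgc hgΩ e
      have h2 := isWeakDeriv_fderiv (Ω := Ω) hr g hg hgc hgΩ e
      rw [h1] at h2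
      rw [neg_inj.1 h2, sub_self]
    · exact hGe.bdd_smul M hg.continuous.aestronglyMeasurable (Eventually.of_forall hM)
    · exact ((hg.continuous.smul hrc).integrable_of_hasCompactSupport hgc.smul_right).integrableOn

/-- The weak Gauss identity satisfied by the fields in `H¹ₙ(Ω)`. -/
theorem integral_mul_trace_add_fderiv_eq_zero {Ω : Set E3} (hΩ : IsBoundedLipschitzDomain Ω)
    {r : E3 → E3} {G : E3 → E3 →L[ℝ] E3} (hG : HasH1Deriv Ω r G)
    (happrox : ∀ ε : ENNReal, 0 < ε → ∃ φ ∈ normalTestFields Ω,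
      eLpNorm (fun x => r x - φ x) 2 (volume.restrict Ω) < ε ∧
      eLpNorm (fun x => G x - fderiv ℝ φ x) 2 (volume.restrict Ω) < ε)
    {ψ : E3 → ℝ} (hψ : ContDiff ℝ ∞ ψ) (hc : HasCompactSupport ψ) :
    ∫ x in Ω, (ψ x * ∑ i, (G x (stdVec i)) i + fderiv ℝ ψ x (r x)) = 0 := by
  have : IsFiniteMeasure (volume.restrict Ω) := ⟨by simpa using hΩ.isBounded.measure_lt_top⟩
  have hψ1 : ContDiff ℝ 1 ψ := hψ.of_le (by simp)
  have hψd := hψ1.continuous_fderiv (by simp)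
  obtain ⟨A, hA⟩ := hψ.continuous.bounded_above_of_compact_support hc
  obtain ⟨B, hB⟩ := hψd.bounded_above_of_compact_support (hc.fderiv (𝕜 := ℝ))
  have hA0 : 0 ≤ A := (norm_nonneg _).trans (hA 0)
  have hB0 : 0 ≤ B := (norm_nonneg _).trans (hB 0)
  -- The integrand as a function linear in the pair (derivative, field), so that the error of an
  -- approximation is `T` of the difference. The 3 in the bound below counts the diagonal entries in
  -- the trace.
  let T : (E3 →L[ℝ] E3) × E3 → E3 → ℝ := fun p x =>
    ψ x * ∑ i, (p.1 (stdVec i)) i + fderiv ℝ ψ x p.2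
  have hTsub : ∀ p q x, T p x - T q x = T (p - q) x := by
    intro p q x
    simp only [T, Prod.fst_sub, Prod.snd_sub, sub_apply, PiLp.sub_apply,
      Finset.sum_sub_distrib, map_sub]
    ring
  have hTbound : ∀ p x, ‖T p x‖ ≤ 3 * A * ‖p.1‖ + B * ‖p.2‖ := by
    intro p x
    refine (norm_add_le _ _).trans (add_le_add ?_ ?_)
    · rw [norm_mul]
      have h1 : ‖∑ i, (p.1 (stdVec i)) i‖ ≤ ∑ _i : Fin 3, ‖p.1‖ := by
        refine norm_sum_le_of_le _ fun i _ => (PiLp.norm_apply_le _ i).trans ?_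
        have := p.1.le_opNorm (stdVec i)
        simpa [stdVec] using this
      rw [Finset.sum_const, Finset.card_univ, Fintype.card_fin] at h1
      calc ‖ψ x‖ * ‖∑ i, (p.1 (stdVec i)) i‖ ≤ A * (3 • ‖p.1‖) :=
            mul_le_mul (hA x) h1 (norm_nonneg _) hA0
        _ = 3 * A * ‖p.1‖ := by simp; ring
    · exact (ContinuousLinearMap.le_opNorm _ _).trans
        (mul_le_mul_of_nonneg_right (hB x) (norm_nonneg _))
  have hTm : ∀ (M : E3 → E3 →L[ℝ] E3) (u : E3 → E3), AEStronglyMeasurable M (volume.restrict Ω) →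
      AEStronglyMeasurable u (volume.restrict Ω) →
      AEStronglyMeasurable (fun x => T (M x, u x) x) (volume.restrict Ω) := by
    intro M u hM hu
    have hcont : Continuous fun q : ((E3 →L[ℝ] E3) × E3) × E3 => T q.1 q.2 := by
      have := hψ.continuous
      fun_prop
    exact hcont.comp_aestronglyMeasurable ((hM.prodMk hu).prodMk aestronglyMeasurable_id)
  -- The Hölder factor `|Ω|^(1 - 1/2)` between the `L¹` and `L²` norms.
  set m : ENNReal :=
    (volume.restrict Ω) univ ^ (1 / (1 : ENNReal).toReal - 1 / (2 : ENNReal).toReal) with hm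
  have hkey : ∀ ε : ENNReal, 0 < ε → ‖∫ x in Ω, T (G x, r x) x‖ₑ ≤
      (‖3 * A‖ₑ * ε + ‖B‖ₑ * ε) * m := by
    intro ε hε
    obtain ⟨φ, ⟨hφ, hφc, hφn⟩, h1, h2⟩ := happrox ε hε
    have hφ1 : ContDiff ℝ 1 φ := hφ.of_le (by simp)
    have hφi : ∫ x in Ω, T (fderiv ℝ φ x, φ x) x = 0 := by
      have := setIntegral_divergence_eq_zero hΩ (hψ1.smul hφ1) hc.smul_right (hφn.smul ψ)
      rw [← this]
      refine integral_congr_ae (Eventually.of_forall fun x => ?_)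
      exact (divergence_smul (hψ1.differentiable (by simp) x)
        (hφ1.differentiable (by simp) x)).symm
    have hi1 : Integrable (fun x => T (G x, r x) x) (volume.restrict Ω) := by
      refine Integrable.mono' (((hG.memLp_deriv.integrable (by norm_num)).norm.const_mul (3 * A)).add
        ((hG.memLp.integrable (by norm_num)).norm.const_mul B))
        (hTm _ _ hG.memLp_deriv.1 hG.memLp.1) (Eventually.of_forall fun x => hTbound _ x)
    have hφd := hφ1.continuous_fderiv (by simp)
    have hi2 : Integrable (fun x => T (fderiv ℝ φ x, φ x) x) (volume.restrict Ω) := by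
      refine Integrable.mono' ((((hφd.integrable_of_hasCompactSupport
        (hφc.fderiv (𝕜 := ℝ))).norm.const_mul (3 * A)).add
        ((hφ1.continuous.integrable_of_hasCompactSupport hφc).norm.const_mul B)).integrableOn)
        (hTm _ _ hφd.aestronglyMeasurable hφ1.continuous.aestronglyMeasurable)
        (Eventually.of_forall fun x => hTbound _ x)
    have hdiff : ∫ x in Ω, T (G x, r x) x = ∫ x in Ω, T (G x - fderiv ℝ φ x, r x - φ x) x := by
      have := integral_sub hi1 hi2
      rw [hφi, sub_zero] at this
      rw [← this]
      simp only [hTsub, Prod.mk_sub_mk]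
    have hm1 : AEStronglyMeasurable (fun x => G x - fderiv ℝ φ x) (volume.restrict Ω) :=
      hG.memLp_deriv.1.sub hφd.aestronglyMeasurable
    have hm2 : AEStronglyMeasurable (fun x => r x - φ x) (volume.restrict Ω) :=
      hG.memLp.1.sub hφ1.continuous.aestronglyMeasurable
    rw [hdiff]
    refine (enorm_integral_le_lintegral_enorm _).trans ?_
    rw [← eLpNorm_one_eq_lintegral_enorm]
    refine (eLpNorm_le_eLpNorm_mul_rpow_measure_univ (q := 2) (by norm_num)
      (hTm _ _ hm1 hm2)).trans ?_
    gcongr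
    calc eLpNorm (fun x => T (G x - fderiv ℝ φ x, r x - φ x) x) 2 (volume.restrict Ω)
        ≤ eLpNorm ((3 * A) • (fun x => ‖G x - fderiv ℝ φ x‖) + B • fun x => ‖r x - φ x‖) 2
            (volume.restrict Ω) := by
          refine eLpNorm_mono_real fun x => ?_
          exact hTbound _ x
      _ ≤ _ := by
          refine (eLpNorm_add_le (hm1.norm.const_smul _) (hm2.norm.const_smul _)
            (by norm_num)).trans ?_
          rw [eLpNorm_const_smul, eLpNorm_const_smul, eLpNorm_norm, eLpNorm_norm]
          gcongr
  have hlim : Tendsto (fun ε : ENNReal => (‖3 * A‖ₑ * ε + ‖B‖ₑ * ε) * m) (𝓝[>] 0) (𝓝 0) := by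
    have hfin : m ≠ ⊤ :=
      ENNReal.rpow_ne_top_of_nonneg (by norm_num) (measure_ne_top _ _)
    have hid : Tendsto (fun ε : ENNReal => ε) (𝓝[>] 0) (𝓝 0) :=
      tendsto_nhdsWithin_of_tendsto_nhds tendsto_id
    have h1 := ENNReal.Tendsto.const_mul (a := ‖3 * A‖ₑ) hid (Or.inr enorm_ne_top)
    have h2 := ENNReal.Tendsto.const_mul (a := ‖B‖ₑ) hid (Or.inr enorm_ne_top)
    have h3 := ENNReal.Tendsto.mul_const (h1.add h2) (Or.inr hfin)
    simpa using h3
  have := ge_of_tendsto hlim (eventually_nhdsWithin_of_forall fun ε hε => hkey ε hε)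
  simpa using this

/-! ### Rotations and their generator -/

/-- The vector product with a fixed vector as a linear map. -/
def crossL (σ : E3) : E3 →L[ℝ] E3 :=
  LinearMap.toContinuousLinearMap
    { toFun := cross σ
      map_add' := fun x y => by simp [cross]
      map_smul' := fun c x => by simp [cross] }

theorem crossL_apply (σ x : E3) : crossL σ x = cross σ x := rfl

theorem cross_self_eq_zero (σ : E3) : cross σ σ = 0 := by
  simp [cross]

theorem inner_cross_self (σ x : E3) : inner ℝ σ (cross σ x) = 0 := by
  simp [cross, crossProduct, PiLp.inner_apply, Fin.sum_univ_three]
  ring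

theorem cross_cross_self {σ : E3} (hσ : ‖σ‖ = 1) (x : E3) :
    cross σ (cross σ x) = inner ℝ σ x • σ - x := by
  have h : σ 0 ^ 2 + σ 1 ^ 2 + σ 2 ^ 2 = 1 := by
    have := EuclideanSpace.real_norm_sq_eq σ
    rw [hσ, Fin.sum_univ_three] at this
    linarith
  ext i
  fin_cases i <;> simp [cross, crossProduct, PiLp.inner_apply, Fin.sum_univ_three]
  · linear_combination (-x 0) * h
  · linear_combination (-x 1) * h
  · linear_combination (-x 2) * h

theorem sum_cross_stdVec (σ : E3) : ∑ i, (cross σ (stdVec i)) i = 0 := by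
  simp [cross, crossProduct, stdVec, Fin.sum_univ_three]

/-- The linear part of a rotation. -/
def rotLin (σ : E3) (θ : ℝ) : E3 →L[ℝ] E3 :=
  Real.cos θ • ContinuousLinearMap.id ℝ E3 + Real.sin θ • crossL σ
    + (1 - Real.cos θ) • (innerSL ℝ σ).smulRight σ

theorem rotLin_apply (σ : E3) (θ : ℝ) (v : E3) :
    rotLin σ θ v = Real.cos θ • v + Real.sin θ • cross σ v
      + ((1 - Real.cos θ) * inner ℝ σ v) • σ := by
  simp [rotLin, crossL_apply, mul_smul]

theorem axisRotation_eq (σ p : E3) (θ : ℝ) (x : E3) :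
    axisRotation σ p θ x = p + rotLin σ θ (x - p) := by
  rw [axisRotation, rotLin_apply]
  abel

/-- The terms along `σ` drop out on both sides. In consequence a rotation carries its own velocity
field to itself. -/
theorem cross_rotLin (σ : E3) (θ : ℝ) (v : E3) :
    cross σ (rotLin σ θ v) = rotLin σ θ (cross σ v) := by
  rw [rotLin_apply, rotLin_apply, inner_cross_self, ← crossL_apply σ (_ + _)]
  simp only [map_add, map_smul, crossL_apply, cross_self_eq_zero]
  simp

theorem rotLin_neg_rotLin {σ : E3} (hσ : ‖σ‖ = 1) (θ : ℝ) (v : E3) :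
    rotLin σ (-θ) (rotLin σ θ v) = v := by
  rw [rotLin_apply σ (-θ), cross_rotLin σ, rotLin_apply, rotLin_apply, cross_cross_self hσ,
    inner_cross_self, inner_add_right, inner_add_right]
  simp only [inner_smul_right, inner_cross_self, real_inner_self_eq_norm_sq, hσ, Real.cos_neg,
    Real.sin_neg]
  match_scalars
  · linear_combination Real.sin_sq_add_cos_sq θ
  · ring
  · linear_combination (-inner ℝ σ v) * Real.sin_sq_add_cos_sq θ

theorem hasDerivAt_rotLin {σ : E3} (hσ : ‖σ‖ = 1) (v : E3) (θ : ℝ) :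
    HasDerivAt (fun t => rotLin σ t v) (cross σ (rotLin σ θ v)) θ := by
  have h1 := (((Real.hasDerivAt_cos θ).smul_const v).add
    ((Real.hasDerivAt_sin θ).smul_const (cross σ v))).add
    ((((Real.hasDerivAt_cos θ).const_sub 1).mul_const (inner ℝ σ v)).smul_const σ)
  rw [cross_rotLin σ, rotLin_apply, cross_cross_self hσ, inner_cross_self]
  refine (h1.congr_deriv ?_).congr_of_eventuallyEq (Eventually.of_forall fun t => ?_)
  · module
  · exact rotLin_apply σ t v

/-- A crude bound whose point is uniformity in `θ`, needed for dominated differentiation. The 3 is 1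
from `cos θ` plus 2 from `1 - cos θ`. -/
theorem norm_rotLin_le {σ : E3} (hσ : ‖σ‖ = 1) (θ : ℝ) (v : E3) :
    ‖rotLin σ θ v‖ ≤ (3 + ‖crossL σ‖) * ‖v‖ := by
  rw [rotLin_apply]
  have h1 : ‖Real.cos θ • v‖ ≤ ‖v‖ := by
    rw [norm_smul]
    exact mul_le_of_le_one_left (norm_nonneg _) (Real.abs_cos_le_one θ)
  have h2 : ‖Real.sin θ • cross σ v‖ ≤ ‖crossL σ‖ * ‖v‖ := by
    rw [norm_smul]
    exact (mul_le_of_le_one_left (norm_nonneg _) (Real.abs_sin_le_one θ)).trans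
      ((crossL σ).le_opNorm v)
  have h3 : ‖((1 - Real.cos θ) * inner ℝ σ v) • σ‖ ≤ 2 * ‖v‖ := by
    rw [norm_smul, hσ, mul_one, norm_mul]
    have h4 : ‖inner ℝ σ v‖ ≤ ‖v‖ := by simpa [hσ] using norm_inner_le_norm (𝕜 := ℝ) σ v
    have h5 : ‖1 - Real.cos θ‖ ≤ 2 := by
      rw [Real.norm_eq_abs, abs_le]
      constructor <;> linarith [Real.neg_one_le_cos θ, Real.cos_le_one θ]
    exact mul_le_mul h5 h4 (norm_nonneg _) (by norm_num)
  calc _ ≤ ‖v‖ + ‖crossL σ‖ * ‖v‖ + 2 * ‖v‖ :=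
        (norm_add_le _ _).trans (add_le_add ((norm_add_le _ _).trans (add_le_add h1 h2)) h3)
    _ = _ := by ring

theorem hasDerivAt_axisRotation {σ : E3} (hσ : ‖σ‖ = 1) (p x : E3) (θ : ℝ) :
    HasDerivAt (fun t => axisRotation σ p t x) (cross σ (axisRotation σ p θ x - p)) θ := by
  simp only [axisRotation_eq, add_sub_cancel_left]
  exact (hasDerivAt_rotLin hσ _ θ).const_add p

theorem axisRotation_neg {σ : E3} (hσ : ‖σ‖ = 1) (p : E3) (θ : ℝ) (x : E3) :
    axisRotation σ p (-θ) (axisRotation σ p θ x) = x := by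
  simp only [axisRotation_eq, add_sub_cancel_left, rotLin_neg_rotLin hσ, add_sub_cancel]

theorem axisRotation_zero (σ p x : E3) : axisRotation σ p 0 x = x := by
  simp [axisRotation]

theorem contDiff_axisRotation (σ p : E3) (θ : ℝ) {n : WithTop ℕ∞} :
    ContDiff ℝ n (axisRotation σ p θ) := by
  have : axisRotation σ p θ = fun x => p + rotLin σ θ (x - p) := funext (axisRotation_eq σ p θ)
  rw [this]
  fun_prop

theorem hasFDerivAt_axisRotation (σ p : E3) (θ : ℝ) (x : E3) :
    HasFDerivAt (axisRotation σ p θ) (rotLin σ θ) x := by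
  have : axisRotation σ p θ = fun x => p + rotLin σ θ (x - p) := funext (axisRotation_eq σ p θ)
  rw [this]
  exact ((rotLin σ θ).hasFDerivAt.comp x ((hasFDerivAt_id x).sub_const p)).const_add p

/-- Rotations are homeomorphisms. -/
def axisRotationHomeomorph {σ : E3} (hσ : ‖σ‖ = 1) (p : E3) (θ : ℝ) : E3 ≃ₜ E3 where
  toFun := axisRotation σ p θ
  invFun := axisRotation σ p (-θ)
  left_inv := axisRotation_neg hσ p θ
  right_inv x := by simpa using axisRotation_neg hσ p (-θ) x
  continuous_toFun := (contDiff_axisRotation σ p θ (n := 0)).continuous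
  continuous_invFun := (contDiff_axisRotation σ p (-θ) (n := 0)).continuous

/-! ### Rotation fields of axisymmetric domains -/

theorem exists_cutoff {Ω : Set E3} (hb : Bornology.IsBounded Ω) :
    ∃ χ : E3 → ℝ, ContDiff ℝ ∞ χ ∧ HasCompactSupport χ ∧ ∀ x ∈ Ω, χ =ᶠ[𝓝 x] 1 := by
  obtain ⟨R, hR0, hR⟩ := hb.subset_ball_lt 0 0
  let χ : ContDiffBump (0 : E3) := ⟨R, R + 1, hR0, by linarith⟩
  exact ⟨χ, χ.contDiff, χ.hasCompactSupport, fun x hx => χ.eventuallyEq_one_of_mem_ball (hR hx)⟩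

theorem memLp_of_continuous {F : Type*} [NormedAddCommGroup F]
    [SecondCountableTopologyEither E3 F] {Ω : Set E3} (hΩ : IsOpen Ω)
    (hb : Bornology.IsBounded Ω) {f : E3 → F} (hf : Continuous f) (q : ENNReal) :
    MemLp f q (volume.restrict Ω) := by
  have : IsFiniteMeasure (volume.restrict Ω) := ⟨by simpa using hb.measure_lt_top⟩
  obtain ⟨C, hC⟩ := hb.isCompact_closure.exists_bound_of_continuousOn hf.continuousOn
  refine MemLp.of_bound hf.aestronglyMeasurable C ?_
  exact (ae_restrict_iff' hΩ.measurableSet).2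
    (Eventually.of_forall fun x hx => hC x (subset_closure hx))

/-- At points with an outer normal, this normal is orthogonal to the velocity of a curve that
stays in the boundary. -/
theorem IsOuterUnitNormal.inner_eq_zero {Ω : Set E3} {x n w : E3} (hn : IsOuterUnitNormal Ω x n)
    {c : ℝ → E3} (hc : HasDerivAt c w 0) (hx : c 0 = x) (hfr : ∀ t, c t ∈ frontier Ω) :
    inner ℝ n w = 0 := by
  obtain ⟨-, U, L, h, hch, hxU, hd, rfl⟩ := hn
  have h1 : HasDerivAt (fun t => splitCoord (L (c t))) (splitCoord (L w)) 0 :=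
    splitCoord.hasFDerivAt.comp_hasDerivAt (0 : ℝ)
      (L.toContinuousLinearEquiv.hasFDerivAt.comp_hasDerivAt (0 : ℝ) hc)
  have h2 : HasDerivAt (fun t => horiz (L (c t))) (horiz (L w)) 0 := h1.fst
  have h3 : HasDerivAt (fun t => (L (c t)) 2) ((L w) 2) 0 := h1.snd
  have h4 : HasDerivAt (fun t => h (horiz (L (c t)))) (fderiv ℝ h (horiz (L x)) (horiz (L w))) 0 := by
    subst hx
    exact hd.hasFDerivAt.comp_hasDerivAt (0 : ℝ) h2
  -- Near time 0 the curve lies in the graph, so its height has two expressions, whose derivatives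
  -- must agree.
  have h5 : ∀ᶠ t in 𝓝 (0 : ℝ), (L (c t)) 2 = h (horiz (L (c t))) := by
    have := hc.continuousAt.preimage_mem_nhds (hch.isOpen.mem_nhds (by rwa [hx]))
    filter_upwards [this] with t ht
    exact (hch.mem_frontier_iff _ ht).1 (hfr t)
  have h6 := (h4.congr_of_eventuallyEq h5).unique h3
  rw [← L.inner_map_map, L.apply_symm_apply, inner_graphNormal, h6, sub_self, mul_zero]

theorem cross_sub_mem_rigidMotions (σ b : E3) : (fun x => cross σ (x - b)) ∈ rigidMotions := by
  refine ⟨!![0, -σ 2, σ 1; σ 2, 0, -σ 0; -σ 1, σ 0, 0], -cross σ b, ?_, fun x => ?_⟩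
  · ext i j
    fin_cases i <;> fin_cases j <;> simp
  · ext i
    fin_cases i <;> simp [cross, crossProduct, dotProduct, Fin.sum_univ_three] <;>
      ring

/-- The cut-off field is itself a test field and agrees with the original on `Ω` together with its
derivative, so both approximation errors are zero. -/
theorem cross_sub_mem_H1n {Ω : Set E3} (hΩ : IsBoundedLipschitzDomain Ω) {σ b : E3} (hσ : ‖σ‖ = 1)
    (hax : IsAxisymmetric Ω σ b) : (fun x => cross σ (x - b)) ∈ H1n Ω := by
  set r : E3 → E3 := fun x => cross σ (x - b) with hr
  have hrd : ContDiff ℝ ∞ r := (crossL σ).contDiff.comp (contDiff_id.sub contDiff_const)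
  have hr1 : ContDiff ℝ 1 r := hrd.of_le (by simp)
  obtain ⟨χ, hχ, hχc, hχ1⟩ := exists_cutoff hΩ.isBounded
  refine ⟨fderiv ℝ r, ⟨memLp_of_continuous hΩ.isOpen hΩ.isBounded hrd.continuous 2,
    memLp_of_continuous hΩ.isOpen hΩ.isBounded (hr1.continuous_fderiv (by simp)) 2,
    isWeakDeriv_fderiv hr1⟩, fun ε hε => ⟨fun x => χ x • r x,
      ⟨hχ.smul hrd, hχc.smul_right, ?_⟩, ?_, ?_⟩⟩
  · refine NormalComponentVanishes.smul ?_ χ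
    refine (ae_restrict_iff' isClosed_frontier.measurableSet).2 (Eventually.of_forall ?_)
    intro x hx n hn
    have hder := hasDerivAt_axisRotation hσ b x 0
    rw [axisRotation_zero] at hder
    refine hn.inner_eq_zero hder (axisRotation_zero σ b x) fun t => ?_
    -- A homeomorphism that preserves `Ω` preserves its frontier, so the orbit of `x` stays there.
    have h1 := (axisRotationHomeomorph hσ b t).image_frontier Ω
    have h2 : axisRotationHomeomorph hσ b t '' Ω = Ω := hax t
    rw [h2] at h1
    rw [← h1]
    exact ⟨x, hx, rfl⟩
  · have : (fun x => r x - χ x • r x) =ᵐ[volume.restrict Ω] 0 := by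
      refine (ae_restrict_iff' hΩ.isOpen.measurableSet).2 (Eventually.of_forall fun x hx => ?_)
      simp [(hχ1 x hx).eq_of_nhds]
    rw [eLpNorm_congr_ae this, eLpNorm_zero]
    exact hε
  · have : (fun x => fderiv ℝ r x - fderiv ℝ (fun x => χ x • r x) x) =ᵐ[volume.restrict Ω] 0 := by
      refine (ae_restrict_iff' hΩ.isOpen.measurableSet).2 (Eventually.of_forall fun x hx => ?_)
      have : (fun x => χ x • r x) =ᶠ[𝓝 x] r := by
        filter_upwards [hχ1 x hx] with y hy
        simp [hy]
      simp [this.fderiv_eq]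
    rw [eLpNorm_congr_ae this]
    exact (eLpNorm_zero (ε := E3 →L[ℝ] E3)).trans_lt hε

/-! ### From weak invariance to axisymmetry -/

/-- A boundary point moved upwards in its chart is neither below nor on the graph, so it leaves
`closure Ω`. This excludes slits. -/
theorem IsBoundedLipschitzDomain.interior_closure {Ω : Set E3} (hΩ : IsBoundedLipschitzDomain Ω) :
    interior (closure Ω) = Ω := by
  refine Subset.antisymm (fun x hx => ?_) (interior_maximal subset_closure hΩ.isOpen)
  by_contra hxΩ
  have hxf : x ∈ frontier Ω := by
    rw [hΩ.isOpen.frontier_eq]; exact ⟨interior_subset hx, hxΩ⟩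
  obtain ⟨U, L, h, hxU, hch⟩ := hΩ.boundary x hxf
  let c : ℝ → E3 := fun t => x + t • L.symm (stdVec 2)
  have hc : Continuous c := by fun_prop
  have hev : ∀ᶠ t in 𝓝 (0 : ℝ), c t ∈ U ∩ interior (closure Ω) := by
    refine hc.continuousAt.preimage_mem_nhds ((hch.isOpen.inter isOpen_interior).mem_nhds ?_)
    simpa [c] using ⟨hxU, hx⟩
  obtain ⟨t, ⟨htU, htc⟩, ht0⟩ := ((hev.filter_mono nhdsWithin_le_nhds).and
    (self_mem_nhdsWithin (s := Ioi (0 : ℝ)))).exists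
  have hL : L (c t) = L x + t • stdVec 2 := by simp [c]
  have hv : (L (c t)) 2 = (L x) 2 + t := by simp [hL, stdVec]
  have hh : horiz (L (c t)) = horiz (L x) := by
    rw [hL]
    ext i
    fin_cases i <;> simp [horiz, stdVec]
  have hxg := (hch.mem_frontier_iff x hxU).1 hxf
  have ht0' : 0 < t := ht0
  by_cases htΩ : c t ∈ Ω
  · have := (hch.mem_iff _ htU).1 htΩ
    rw [hv, hh] at this
    linarith
  · have hf : c t ∈ frontier Ω := by
      rw [hΩ.isOpen.frontier_eq]; exact ⟨interior_subset htc, htΩ⟩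
    have := (hch.mem_frontier_iff _ htU).1 hf
    rw [hv, hh] at this
    linarith

/-- If the indicator function of `Ω` is invariant, in the weak sense, under an infinitesimal
rotation, then the rotations map `Ω` into its closure. -/
theorem axisRotation_mem_closure {Ω : Set E3} (hΩ : IsOpen Ω) (hb : Bornology.IsBounded Ω)
    {σ p : E3} (hσ : ‖σ‖ = 1)
    (h : ∀ ψ : E3 → ℝ, ContDiff ℝ ∞ ψ → HasCompactSupport ψ →
      ∫ x in Ω, fderiv ℝ ψ x (cross σ (x - p)) = 0) (θ : ℝ) {x : E3} (hx : x ∈ Ω) :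
    axisRotation σ p θ x ∈ closure Ω := by
  by_contra hne
  -- A bump at the rotated point, supported off `closure Ω`: its integral over `Ω` is zero, while
  -- that of its composition with the rotation is positive.
  obtain ⟨ψ, hψs, hψc, hψ, hψr, hψ1⟩ := exists_contDiff_tsupport_subset (n := ⊤)
    (isClosed_closure.isOpen_compl.mem_nhds hne)
  replace hψ : ContDiff ℝ ∞ ψ := hψ
  have hψ0 : ∀ y, 0 ≤ ψ y := fun y => (hψr ⟨y, rfl⟩).1
  have hψ1d : ContDiff ℝ 1 ψ := hψ.of_le (by simp)
  have hψd : Differentiable ℝ ψ := hψ1d.differentiable (by simp)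
  have hψfc := hψ1d.continuous_fderiv (by simp)
  obtain ⟨B, hB⟩ := hψfc.bounded_above_of_compact_support (hψc.fderiv (𝕜 := ℝ))
  have hB0 : 0 ≤ B := (norm_nonneg _).trans (hB 0)
  have hrc : ∀ t, Continuous (axisRotation σ p t) := fun t =>
    (contDiff_axisRotation σ p t (n := 0)).continuous
  have hint : ∀ {f : E3 → ℝ}, Continuous f → Integrable f (volume.restrict Ω) := fun hf =>
    (memLp_one_iff_integrable).1 (memLp_of_continuous hΩ hb hf 1)
  have hder : ∀ t, HasDerivAt (fun t => ∫ y in Ω, ψ (axisRotation σ p t y)) 0 t := by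
    intro t
    have h1 := hasDerivAt_integral_of_dominated_loc_of_deriv_le (μ := volume.restrict Ω)
      (F := fun t y => ψ (axisRotation σ p t y))
      (F' := fun t y => fderiv ℝ ψ (axisRotation σ p t y) (cross σ (axisRotation σ p t y - p)))
      (x₀ := t) (s := univ)
      (bound := fun y => B * (‖crossL σ‖ * ((3 + ‖crossL σ‖) * ‖y - p‖))) univ_mem
      (Eventually.of_forall fun s => (hψ.continuous.comp (hrc s)).aestronglyMeasurable)
      (hint (hψ.continuous.comp (hrc t)))
      (Continuous.aestronglyMeasurable ((hψfc.comp (hrc t)).clm_apply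
        ((crossL σ).continuous.comp ((hrc t).sub continuous_const))))
      (Eventually.of_forall fun y s _ => ?_)
      (hint (by fun_prop))
      (Eventually.of_forall fun y s _ =>
        (hψd _).hasFDerivAt.comp_hasDerivAt s (hasDerivAt_axisRotation hσ p y s))
    · refine h1.2.congr_deriv ?_
      -- The hypothesis is applied to `ψ` composed with the rotation; `cross_rotLin` matches the
      -- chain rule with the derivative in the angle.
      rw [← h (fun y => ψ (axisRotation σ p t y)) (hψ.comp (contDiff_axisRotation σ p t))
        (hψc.comp_homeomorph (axisRotationHomeomorph hσ p t))]
      refine integral_congr_ae (Eventually.of_forall fun y => ?_)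
      have h2 := ((hψd _).hasFDerivAt.comp y (hasFDerivAt_axisRotation σ p t y)).fderiv
      simp only [Function.comp_def] at h2
      simp only [h2, ContinuousLinearMap.comp_apply]
      rw [axisRotation_eq, add_sub_cancel_left, cross_rotLin σ]
    · refine (ContinuousLinearMap.le_opNorm _ _).trans (mul_le_mul (hB _) ?_ (norm_nonneg _) hB0)
      refine ((crossL σ).le_opNorm _).trans (mul_le_mul_of_nonneg_left ?_ (norm_nonneg _))
      rw [axisRotation_eq, add_sub_cancel_left]
      exact norm_rotLin_le hσ s _
  have hconst := is_const_of_deriv_eq_zero (fun t => (hder t).differentiableAt)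
    (fun t => (hder t).deriv) θ 0
  simp only [axisRotation_zero] at hconst
  have hzero : ∫ y in Ω, ψ y = 0 := by
    refine setIntegral_eq_zero_of_forall_eq_zero fun y hy => ?_
    by_contra hy0
    exact hψs (subset_tsupport _ hy0) (subset_closure hy)
  rw [hzero] at hconst
  have hcont := hψ.continuous.comp (hrc θ)
  have hpos : 0 < ∫ y in Ω, ψ (axisRotation σ p θ y) := by
    refine (setIntegral_pos_iff_support_of_nonneg_ae (Eventually.of_forall fun y => hψ0 _)
      (hint hcont)).2 ?_
    refine IsOpen.measure_pos _ ((isOpen_ne_fun hcont continuous_const).inter hΩ)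
      ⟨x, ?_, hx⟩
    simp [hψ1]
  exact hpos.ne' hconst

/-- The image of `Ω` is open and lies in `closure Ω`, hence in its interior `Ω`; the opposite
rotation gives the other inclusion. -/
theorem isAxisymmetric_of_weak_invariance {Ω : Set E3} (hΩ : IsBoundedLipschitzDomain Ω)
    {σ p : E3} (hσ : ‖σ‖ = 1)
    (h : ∀ ψ : E3 → ℝ, ContDiff ℝ ∞ ψ → HasCompactSupport ψ →
      ∫ x in Ω, fderiv ℝ ψ x (cross σ (x - p)) = 0) : IsAxisymmetric Ω σ p := by
  have hmaps : ∀ θ, axisRotation σ p θ '' Ω ⊆ Ω := by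
    intro θ
    have ho : IsOpen (axisRotation σ p θ '' Ω) :=
      (axisRotationHomeomorph hσ p θ).isOpenMap Ω hΩ.isOpen
    have := interior_maximal (s := closure Ω) ?_ ho
    · rwa [hΩ.interior_closure] at this
    · rintro _ ⟨x, hx, rfl⟩
      exact axisRotation_mem_closure hΩ.isOpen hΩ.isBounded hσ h θ hx
  intro θ
  refine Subset.antisymm (hmaps θ) fun x hx => ?_
  exact ⟨_, hmaps (-θ) ⟨x, hx, rfl⟩, by simpa using axisRotation_neg hσ p (-θ) x⟩

/-! ### Rigid motions in `H¹ₙ(Ω)` -/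

/-- A rigid motion in `H¹ₙ(Ω)` leaves the indicator function of `Ω` invariant in the weak sense. -/
theorem integral_fderiv_rigidMotion_eq_zero {Ω : Set E3} (hΩ : IsBoundedLipschitzDomain Ω)
    {r : E3 → E3} {σ b : E3} {κ : ℝ} (hr : r ∈ H1n Ω) (hrx : ∀ x, r x = κ • cross σ x + b)
    {ψ : E3 → ℝ} (hψ : ContDiff ℝ ∞ ψ) (hc : HasCompactSupport ψ) :
    ∫ x in Ω, fderiv ℝ ψ x (r x) = 0 := by
  obtain ⟨G, hG, happrox⟩ := hr
  have hd : ∀ x, HasFDerivAt r (κ • crossL σ) x := by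
    intro x
    have : r = fun x => (κ • crossL σ) x + b := funext hrx
    rw [this]
    exact (κ • crossL σ).hasFDerivAt.add_const b
  have hcd : ContDiff ℝ 1 r := by
    have : r = fun x => (κ • crossL σ) x + b := funext hrx
    rw [this]
    fun_prop
  rw [← integral_mul_trace_add_fderiv_eq_zero hΩ hG happrox hψ hc]
  have hGe := fun i => hG.weakDeriv.ae_eq_fderiv hΩ.isOpen hΩ.isBounded hcd hG.memLp_deriv (stdVec i)
  refine integral_congr_ae ?_
  filter_upwards [ae_all_iff.2 hGe] with x hx
  have h0 : ∑ i, (G x (stdVec i)) i = 0 := by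
    have : ∀ i, (G x (stdVec i)) i = κ * (cross σ (stdVec i)) i := fun i => by
      rw [hx i, (hd x).fderiv]; rfl
    simp only [this]
    rw [← Finset.mul_sum, sum_cross_stdVec, mul_zero]
  rw [h0, mul_zero, zero_add]

/-- The total momentum of a rigid motion in `H¹ₙ(Ω)` vanishes. -/
theorem integral_inner_eq_zero {Ω : Set E3} (hΩ : IsOpen Ω) (hb : Bornology.IsBounded Ω)
    {r : E3 → E3} (h : ∀ ψ : E3 → ℝ, ContDiff ℝ ∞ ψ → HasCompactSupport ψ →
      ∫ x in Ω, fderiv ℝ ψ x (r x) = 0) (c : E3) : ∫ x in Ω, inner ℝ c (r x) = 0 := by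
  obtain ⟨χ, hχ, hχc, hχ1⟩ := exists_cutoff hb
  -- The test function is linear on `Ω`, with gradient `c` there.
  rw [← h (fun x => χ x * inner ℝ c x) (hχ.mul ((innerSL ℝ c).contDiff)) hχc.mul_right]
  refine setIntegral_congr_fun hΩ.measurableSet fun x hx => ?_
  have : (fun x => χ x * inner ℝ c x) =ᶠ[𝓝 x] innerSL ℝ c := by
    filter_upwards [hχ1 x hx] with y hy
    simp [hy]
  simp only [this.fderiv_eq, ContinuousLinearMap.fderiv, innerSL_apply_apply]

theorem eq_zero_of_setIntegral_const_eq_zero {Ω : Set E3} (hΩ : IsBoundedLipschitzDomain Ω) {c : ℝ}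
    (h : ∫ _x in Ω, c = 0) : c = 0 := by
  rw [setIntegral_const, smul_eq_mul] at h
  refine (mul_eq_zero.1 h).resolve_left (ENNReal.toReal_pos ?_ ?_).ne'
  · exact (hΩ.isOpen.measure_pos _ hΩ.isConnected.nonempty).ne'
  · exact hΩ.isBounded.measure_lt_top.ne

end RotBody

end

theorem mainTheorem11 (Ω : Set RotBody.E3) (hΩ : RotBody.IsBoundedLipschitzDomain Ω) :
    (∀ σ b : RotBody.E3, ‖σ‖ = 1 → RotBody.IsAxisymmetric Ω σ b →
      (fun x => RotBody.cross σ (x - b)) ∈ RotBody.rigidMotions ∩ RotBody.H1n Ω) ∧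
    (∀ (r : RotBody.E3 → RotBody.E3) (σ b : RotBody.E3) (ω : ℝ),
      r ∈ RotBody.rigidMotions ∩ RotBody.H1n Ω → r ≠ 0 → ‖σ‖ = 1 →
      (∀ x, r x = ω • RotBody.cross σ x + b) →
      ω ≠ 0 ∧ inner ℝ b σ = 0 ∧
        RotBody.IsAxisymmetric Ω σ ((1 / ω) • RotBody.cross σ b)) := by
  refine ⟨fun σ b hσ hax => ⟨RotBody.cross_sub_mem_rigidMotions σ b,
    RotBody.cross_sub_mem_H1n hΩ hσ hax⟩, fun r σ b ω hr hr0 hσ hrx => ?_⟩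
  have hweak := fun ψ (hψ : ContDiff ℝ _ ψ) (hc : HasCompactSupport ψ) =>
    RotBody.integral_fderiv_rigidMotion_eq_zero hΩ hr.2 hrx hψ hc
  have hmom := RotBody.integral_inner_eq_zero hΩ.isOpen hΩ.isBounded hweak
  have hω : ω ≠ 0 := by
    rintro rfl
    have h1 := hmom b
    simp only [hrx, zero_smul, zero_add] at h1
    have h2 := inner_self_eq_zero.1 (RotBody.eq_zero_of_setIntegral_const_eq_zero hΩ h1)
    exact hr0 (funext fun x => by simp [hrx, h2])
  have hb : inner ℝ σ b = 0 := by
    have h1 := hmom σ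
    simp only [hrx, inner_add_right, inner_smul_right, RotBody.inner_cross_self, mul_zero,
      zero_add] at h1
    exact RotBody.eq_zero_of_setIntegral_const_eq_zero hΩ h1
  refine ⟨hω, by rwa [real_inner_comm], RotBody.isAxisymmetric_of_weak_invariance hΩ hσ ?_⟩
  intro ψ hψ hc
  -- Since `b ⊥ σ`, `σ ∧ (σ ∧ b) = -b`; this is what places the axis at `(1/ω) σ ∧ b`.
  have h1 : ∀ x, RotBody.cross σ (x - (1 / ω) • RotBody.cross σ b) = (1 / ω) • r x := by
    intro x
    rw [← RotBody.crossL_apply, map_sub, map_smul, RotBody.crossL_apply, RotBody.crossL_apply,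
      RotBody.cross_cross_self hσ, hb, hrx, smul_add, smul_smul, one_div_mul_cancel hω]
    simp
  simp only [h1, map_smul, smul_eq_mul]
  rw [MeasureTheory.integral_const_mul, hweak ψ hψ hc, mul_zero]
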